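/- Let $N\ge 1$, $L\ge 1$ and $-1\le a_1<b_1<a_2<b_2<\cdots<a_L<b_L\le 1$, and let $K=\bigcup_{\ell=1}^L[a_\ell,b_\ell]$. Let $\Sigma,\Omega$ be real polynomials that are positive on $K$, and let $w=\Sigma/\Omega$. Then there is exactly one monic real polynomial $\mathcal{T}_N^{K,w}$ of degree $N$ that minimizes $\|P/w\|_K=\max_{x\in K}|P(x)/w(x)|$ among all monic real polynomials $P$ of degree $N$, and its Chebyshev coefficients are given by a semidefinite program, as follows. Let $T_n$ be the classical Chebyshev polynomials of the first kind, let $M=\max\{\deg\Sigma,\deg\Omega+N\}$, write $\Sigma=\sum_{m=0}^M\sigma_mT_m$, and let $\mathbf W\in\mathbb R^{(M+1)\times(N+1)}$ be the matrix for which $\Omega\sum_{n=0}^Np_nT_n=\sum_{m=0}^M(\mathbf W\mathbf p)_mT_m$ for all $\mathbf p=(p_0,\dots,p_N)\in\mathbb R^{N+1}$. Put $$\alpha_\ell=\tfrac12\exp\!\left(\tfrac{i}{2}\arccos a_\ell+\tfrac{i}{2}\arccos b_\ell\right),\qquad \beta_\ell=\cos\!\left(\tfrac12\arccos a_\ell-\tfrac12\arccos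 b_\ell\right).$$ Consider the program: minimize $c$ over $c\in\mathbb R$, $\mathbf p\in\mathbb R^{N+1}$ and, for each sign $\pm$ and each $\ell=1,\dots,L$, Hermitian positive semidefinite matrices $\mathbf Q^{\pm,\ell}\in\mathbb C^{(M+1)\times(M+1)}$, $\mathbf R^{\pm,\ell}\in\mathbb C^{M\times M}$, subject to $p_N=1/2^{N-1}$ and, for each sign, each $\ell$ and each $m=0,\dots,M$, $$\sum_{i-j=m}Q^{\pm,\ell}_{i,j}+\alpha_\ell\sum_{i-j=m-1}R^{\pm,\ell}_{i,j}-\beta_\ell\sum_{i-j=m}R^{\pm,\ell}_{i,j}+\overline{\alpha_\ell}\sum_{i-j=m+1}R^{\pm,\ell}_{i,j}=\begin{cases}\frac12\sigma_mc\pm\frac12(\mathbf W\mathbf p)_m,&1\le m\le M,\\ \sigma_0c\pm(\mathbf W\mathbf p)_0,&m=0.\end{cases}$$ This program has a solution (the minimum is attained), and every solution satisfies $\sum_{n=0}^Np_nT_n=\mathcal{T}_N^{K,w}$ and $c=\|\mathcal{T}_N^{K,w}/w\|_K$. -/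

import Mathlib

open Polynomial
open scoped ComplexOrder

noncomputable section

namespace ChebSDP

/-- The intervals `[a ℓ, b ℓ]` lie in `[-1, 1]`, are nondegenerate, pairwise disjoint, and are
listed from left to right: `-1 ≤ a 0 < b 0 < a 1 < b 1 < ⋯ < a (L-1) < b (L-1) ≤ 1`. -/
structure IsIntervalSystem {L : ℕ} (a b : Fin L → ℝ) : Prop where
  neg_one_le : ∀ l, -1 ≤ a l
  lt : ∀ l, a l < b l
  sep : ∀ l l', l < l' → b l < a l'
  le_one : ∀ l, b l ≤ 1

/-- The union of the intervals `[a ℓ, b ℓ]`. -/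
def intervalUnion {L : ℕ} (a b : Fin L → ℝ) : Set ℝ := ⋃ l, Set.Icc (a l) (b l)

/-- The rational function `S / Om`. -/
def ratWeight (S Om : ℝ[X]) : ℝ → ℝ := fun x => S.eval x / Om.eval x

/-- The weighted max-norm `‖P / w‖_K`, the maximum of `|P x / w x|` over `x ∈ K`
(attained when `K` is compact and nonempty and `w` is continuous and positive on `K`). -/
def weightedNorm (K : Set ℝ) (w : ℝ → ℝ) (P : ℝ[X]) : ℝ :=
  sSup ((fun x => |P.eval x / w x|) '' K)

/-- `P` is a monic polynomial of degree `N` that has minimal weighted max-norm on `K` among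
all monic polynomials of degree `N`. -/
structure IsChebyshevPoly (K : Set ℝ) (w : ℝ → ℝ) (N : ℕ) (P : ℝ[X]) : Prop where
  monic : P.Monic
  natDegree_eq : P.natDegree = N
  norm_le : ∀ P' : ℝ[X], P'.Monic → P'.natDegree = N →
    weightedNorm K w P ≤ weightedNorm K w P'

/-- The classical Chebyshev polynomials of the first kind, as a sequence with `deg (T n) = n`. -/
def chebSequence : Polynomial.Sequence ℝ where
  elems' n := Chebyshev.T ℝ n
  degree_eq' n := by simp [Chebyshev.degree_T]

/-- The basis `T₀, T₁, T₂, …` of `ℝ[X]`. -/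
def chebBasis : Module.Basis ℕ ℝ ℝ[X] :=
  chebSequence.basis fun i =>
    (leadingCoeff_ne_zero.mpr (chebSequence.ne_zero i)).isUnit

theorem chebBasis_apply (n : ℕ) : chebBasis n = Chebyshev.T ℝ n :=
  Polynomial.Sequence.basis_eq_self _ _ _

/-- The `m`-th Chebyshev coefficient of `P`, i.e. `c m` in `P = ∑ m, c m • T m`. -/
def chebCoeff (P : ℝ[X]) (m : ℕ) : ℝ := chebBasis.repr P m

/-- The polynomial `∑_{n=0}^N p n • T n`. -/
def chebSum {N : ℕ} (p : Fin (N + 1) → ℝ) : ℝ[X] :=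
  ∑ n : Fin (N + 1), p n • Chebyshev.T ℝ (n : ℕ)

/-- `M = max {deg S, deg Om + N}`. -/
def sdpDegree (S Om : ℝ[X]) (N : ℕ) : ℕ := max S.natDegree (Om.natDegree + N)

/-- The `(M+1) × (N+1)` matrix, in Chebyshev coefficients, of the linear map `P ↦ Om * P`. -/
def mulMatrix (Om : ℝ[X]) (M N : ℕ) : Matrix (Fin (M + 1)) (Fin (N + 1)) ℝ :=
  Matrix.of fun m n => chebCoeff (Om * Chebyshev.T ℝ (n : ℕ)) m

/-- `α = (1/2) exp ((i/2) arccos a + (i/2) arccos b)`. -/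
def alpha (a b : ℝ) : ℂ :=
  1 / 2 * Complex.exp (Complex.I / 2 * (Real.arccos a : ℂ) + Complex.I / 2 * (Real.arccos b : ℂ))

/-- `β = cos ((1/2) arccos a - (1/2) arccos b)`. -/
def beta (a b : ℝ) : ℝ := Real.cos (1 / 2 * Real.arccos a - 1 / 2 * Real.arccos b)

/-- The sum `∑_{i - j = k} A i j` along a diagonal (an empty sum if there is no such entry). -/
def diagSum {d : ℕ} (A : Matrix (Fin d) (Fin d) ℂ) (k : ℤ) : ℂ :=
  ∑ i : Fin d, ∑ j : Fin d, if (i : ℤ) - (j : ℤ) = k then A i j else 0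

/-- The optimization variables of the semidefinite program. The sign `±` is an element
of `ℤˣ = {1, -1}`. -/
structure SDPVar (L M N : ℕ) where
  c : ℝ
  p : Fin (N + 1) → ℝ
  Q : ℤˣ → Fin L → Matrix (Fin (M + 1)) (Fin (M + 1)) ℂ
  R : ℤˣ → Fin L → Matrix (Fin M) (Fin M) ℂ

/-- The constraints of the semidefinite program. -/
structure SDPFeasible {L : ℕ} (a b : Fin L → ℝ) (S Om : ℝ[X]) (M N : ℕ)
    (v : SDPVar L M N) : Prop where
  leading : v.p (Fin.last N) = 1 / (2 : ℝ) ^ ((N : ℤ) - 1)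
  Q_psd : ∀ (s : ℤˣ) (l : Fin L), (v.Q s l).PosSemidef
  R_psd : ∀ (s : ℤˣ) (l : Fin L), (v.R s l).PosSemidef
  linear : ∀ (s : ℤˣ) (l : Fin L) (m : Fin (M + 1)),
    diagSum (v.Q s l) (m : ℤ)
      + alpha (a l) (b l) * diagSum (v.R s l) ((m : ℤ) - 1)
      - (beta (a l) (b l) : ℂ) * diagSum (v.R s l) (m : ℤ)
      + star (alpha (a l) (b l)) * diagSum (v.R s l) ((m : ℤ) + 1)
    = (((if m = 0 then 1 else 1 / 2) *
        (chebCoeff S m * v.c + ((s : ℤ) : ℝ) * (mulMatrix Om M N).mulVec v.p m) : ℝ) : ℂ)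

/-- `v` solves the semidefinite program: it is feasible and minimizes `c` over all feasible
points. -/
structure SDPSolves {L : ℕ} (a b : Fin L → ℝ) (S Om : ℝ[X]) (M N : ℕ)
    (v : SDPVar L M N) : Prop where
  feasible : SDPFeasible a b S Om M N v
  minimal : ∀ v' : SDPVar L M N, SDPFeasible a b S Om M N v' → v.c ≤ v'.c

end ChebSDP

end

/-! For `P = ∑ p n • T n`, the bound `‖P / w‖_K ≤ c` says that both polynomials `c * S ± Om * P` are
nonnegative on every interval of `K`. The matrices certify exactly this, so the program minimizes
the weighted norm over monic `P` of degree `N`. What remains is the certificate, and existence and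
uniqueness of the minimizer.

Certificate (`exists_linear_constraint_iff`): under `x = cos t` the interval `[a, b]` is the image
of the arc `|t + m| ≤ h`, where `m` and `h` are the half sum and half difference of `arccos a` and
`arccos b`. A polynomial `f` of degree at most `M` is nonnegative on `[a, b]` iff `f (cos t) = ∑
|q|² + (cos (t + m) - cos h) * ∑ |r|²` with `q`, `r` polynomials in `exp (i t)`, `deg q ≤ M` and
`deg r < M`. Such expressions are closed under products, with degrees adding (`mul_mem_arcCone`), so
it suffices to treat the real factors of `f` (`eval_cos_mem_arcCone`). Gram matrices encode the sums
of squares, and comparing Fourier coefficients gives the linear constraints.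

Uniqueness (`IsChebyshevPoly.eq`): a minimizer has at least `N` extremal points, and two minimizers
agree at those of their midpoint. -/

namespace ChebSDP

/-! ### Existence and uniqueness of the weighted Chebyshev polynomial -/

section BestApproximation

variable {K : Set ℝ} {w : ℝ → ℝ}

theorem continuousOn_eval_div (hw : ContinuousOn w K) (hpos : ∀ x ∈ K, 0 < w x) (P : ℝ[X]) :
    ContinuousOn (fun x => P.eval x / w x) K :=
  P.continuous.continuousOn.div hw fun x hx => (hpos x hx).ne'

theorem le_weightedNorm (hK : IsCompact K) (hw : ContinuousOn w K) (hpos : ∀ x ∈ K, 0 < w x)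
    (P : ℝ[X]) {x : ℝ} (hx : x ∈ K) : |P.eval x / w x| ≤ weightedNorm K w P :=
  le_csSup (hK.bddAbove_image (continuousOn_eval_div hw hpos P).abs) ⟨x, hx, rfl⟩

theorem weightedNorm_le (hne : K.Nonempty) {P : ℝ[X]} {c : ℝ}
    (h : ∀ x ∈ K, |P.eval x / w x| ≤ c) : weightedNorm K w P ≤ c := by
  refine csSup_le (hne.image _) ?_
  rintro _ ⟨x, hx, rfl⟩
  exact h x hx

theorem exists_weightedNorm_eq (hK : IsCompact K) (hne : K.Nonempty) (hw : ContinuousOn w K)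
    (hpos : ∀ x ∈ K, 0 < w x) (P : ℝ[X]) :
    ∃ x ∈ K, weightedNorm K w P = |P.eval x / w x| :=
  hK.exists_sSup_image_eq hne (continuousOn_eval_div hw hpos P).abs

/-- The restriction of `P / w` to `K`, as a linear map in `P`. -/
noncomputable def divWeight (hw : ContinuousOn w K) (hpos : ∀ x ∈ K, 0 < w x) :
    ℝ[X] →ₗ[ℝ] C(K, ℝ) where
  toFun P := ⟨K.domRestrict fun x => P.eval x / w x, (continuousOn_eval_div hw hpos P).domRestrict⟩
  map_add' P Q := by ext x; simp [add_div]
  map_smul' r P := by ext x; simp [mul_div_assoc]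

theorem norm_divWeight [CompactSpace K] (hne : K.Nonempty) (hw : ContinuousOn w K)
    (hpos : ∀ x ∈ K, 0 < w x) (P : ℝ[X]) : ‖divWeight hw hpos P‖ = weightedNorm K w P := by
  have hK : IsCompact K := isCompact_iff_compactSpace.mpr inferInstance
  apply le_antisymm
  · obtain ⟨x, hx⟩ := hne
    refine (ContinuousMap.norm_le _ ((abs_nonneg _).trans (le_weightedNorm hK hw hpos P hx))).2 ?_
    exact fun y => le_weightedNorm hK hw hpos P y.2
  · exact weightedNorm_le hne fun x hx => (divWeight hw hpos P).norm_coe_le_norm ⟨x, hx⟩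

theorem monic_add_and_natDegree {N : ℕ} {P D : ℝ[X]} (hP : P.Monic) (hN : P.natDegree = N)
    (hD : D.degree < (N : WithBot ℕ)) : (P + D).Monic ∧ (P + D).natDegree = N := by
  have hlt : D.degree < P.degree := by rwa [degree_eq_natDegree hP.ne_zero, hN]
  exact ⟨hP.add_of_left hlt, by rw [natDegree_add_eq_left_of_degree_lt hlt, hN]⟩

theorem degree_sub_lt_of_monic {N : ℕ} {P Q : ℝ[X]} (hP : P.Monic) (hQ : Q.Monic)
    (hPN : P.natDegree = N) (hQN : Q.natDegree = N) : (P - Q).degree < (N : WithBot ℕ) := by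
  have hd : P.degree = (N : WithBot ℕ) := by rw [degree_eq_natDegree hP.ne_zero, hPN]
  have := degree_sub_lt_left (p := P) (q := Q)
    (by rw [hd, degree_eq_natDegree hQ.ne_zero, hQN]) hP.ne_zero (by rw [hP, hQ])
  rwa [hd] at this

theorem degree_C_mul_lt {r : ℝ} {N : ℕ} {Q : ℝ[X]} (hQ : Q.degree < (N : WithBot ℕ)) :
    (C r * Q).degree < (N : WithBot ℕ) := by
  rw [← smul_eq_C_mul]
  exact (degree_smul_le _ _).trans_lt hQ

/-- This is best approximation of `X ^ N` from a finite-dimensional subspace of `C(K, ℝ)`: the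
distance is continuous and coercive there, hence attains its minimum. -/
theorem exists_isChebyshevPoly (hK : IsCompact K) (hne : K.Nonempty) (hw : ContinuousOn w K)
    (hpos : ∀ x ∈ K, 0 < w x) (N : ℕ) : ∃ P, IsChebyshevPoly K w N P := by
  have : CompactSpace K := isCompact_iff_compactSpace.mp hK
  set φ := divWeight hw hpos
  let V : Submodule ℝ C(K, ℝ) := (degreeLT ℝ N).map φ
  have : FiniteDimensional ℝ (degreeLT ℝ N) :=
    (degreeLTEquiv ℝ N).symm.finiteDimensional
  have : FiniteDimensional ℝ V := inferInstance
  have : ProperSpace V := FiniteDimensional.proper ℝ V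
  obtain ⟨⟨_, Q, hQ, rfl⟩, hv⟩ := Continuous.exists_forall_le (α := ℝ)
    (f := fun v : V => ‖φ (X ^ N) + v‖) (by fun_prop) (by
      refine Filter.tendsto_atTop_mono (f := fun v : V => -‖φ (X ^ N)‖ + ‖v‖) (fun v => ?_)
        (Filter.tendsto_atTop_add_const_left _ _ tendsto_norm_cocompact_atTop)
      have := norm_sub_le (φ (X ^ N) + v) (φ (X ^ N))
      rw [add_sub_cancel_left] at this
      change -‖φ (X ^ N)‖ + ‖(v : C(K, ℝ))‖ ≤ _
      linarith)
  have hQd : Q.degree < N := mem_degreeLT.mp hQ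
  obtain ⟨hm, hd⟩ := monic_add_and_natDegree (monic_X_pow N) (natDegree_X_pow N) hQd
  refine ⟨X ^ N + Q, hm, hd, fun P' hm hd => ?_⟩
  · have hlt := degree_sub_lt_of_monic hm (monic_X_pow N) hd (natDegree_X_pow N)
    have := hv ⟨φ (P' - X ^ N), Submodule.mem_map_of_mem (mem_degreeLT.mpr hlt)⟩
    rw [← norm_divWeight hne hw hpos, ← norm_divWeight hne hw hpos]
    simpa [φ] using this

theorem abs_sub_mul_lt {p q ε : ℝ} (hε : 0 < ε) (hpq : ε * q ^ 2 < 2 * (p * q)) :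
    |p - ε * q| < |p| := by
  rw [← sq_lt_sq]
  nlinarith

/-- With fewer than `N` extremal points, some `Q` of degree below `N` interpolates `P` at all of
them. Then `P - ε Q` is still monic of degree `N`, and for small `ε > 0` its norm is strictly
smaller. -/
theorem IsChebyshevPoly.card_le_of_extremal (hK : IsCompact K) (hinf : K.Infinite)
    (hw : ContinuousOn w K) (hpos : ∀ x ∈ K, 0 < w x) {N : ℕ} {P : ℝ[X]}
    (hP : IsChebyshevPoly K w N P) (s : Finset ℝ)
    (hs : ∀ x ∈ K, |P.eval x / w x| = weightedNorm K w P → x ∈ s) : N ≤ s.card := by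
  by_contra! hcard
  set E := weightedNorm K w P
  have hE : 0 < E := by
    by_contra! hE
    refine hP.monic.ne_zero (eq_zero_of_infinite_isRoot P (hinf.mono fun x hx => ?_))
    have h0 := (le_weightedNorm hK hw hpos P hx).trans hE
    have := abs_nonpos_iff.mp h0
    exact (div_eq_zero_iff.mp this).resolve_right (hpos x hx).ne'
  set Q := Lagrange.interpolate s id fun x => P.eval x
  have hinj : Set.InjOn (id : ℝ → ℝ) s := Function.injective_id.injOn
  have hQd : Q.degree < N :=
    (Lagrange.degree_interpolate_lt _ hinj).trans (by exact_mod_cast hcard)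
  have hQs : ∀ x ∈ s, Q.eval x = P.eval x := fun x hx =>
    Lagrange.eval_interpolate_at_node (fun x => P.eval x) hinj hx
  have hev : ∀ᶠ ε in nhdsWithin (0 : ℝ) (Set.Ioi 0), ∀ y ∈ K,
      |P.eval y - ε * Q.eval y| < E * w y := by
    -- Compactness makes `ε` uniform in `y`. The repeated `y ∈ K` and the condition `0 < ε` sit
    -- inside the claim because it is checked on full neighbourhoods of `(0, y)`.
    have key : ∀ᶠ ε in nhds (0 : ℝ), ∀ y ∈ K, y ∈ K → 0 < ε →
        |P.eval y - ε * Q.eval y| < E * w y := by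
      refine hK.eventually_forall_of_forall_eventually fun y hy => ?_
      have hle : ∀ x ∈ K, |P.eval x| ≤ E * w x := fun x hx => by
        have := le_weightedNorm hK hw hpos P hx
        rwa [abs_div, abs_of_pos (hpos x hx), div_le_iff₀ (hpos x hx)] at this
      rcases (hle y hy).lt_or_eq with hlt | heq
      · have hwc : ContinuousWithinAt (fun z : ℝ × ℝ => E * w z.2)
            (Set.univ ×ˢ K) ((0 : ℝ), y) :=
          continuousWithinAt_const.mul
            ((hw y hy).comp continuousWithinAt_snd fun z hz => hz.2)
        have hpc : ContinuousWithinAt (fun z : ℝ × ℝ => |P.eval z.2 - z.1 * Q.eval z.2|)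
            (Set.univ ×ˢ K) ((0 : ℝ), y) := by fun_prop
        have := hpc.eventually_lt hwc (by simpa using hlt)
        filter_upwards [eventually_nhdsWithin_iff.mp this] with z hz hzK _
        exact hz ⟨trivial, hzK⟩
      · have hQy : Q.eval y = P.eval y := hQs y (hs y hy (by
          rw [abs_div, abs_of_pos (hpos y hy), heq, mul_div_cancel_right₀ _ (hpos y hy).ne']))
        have hne : P.eval y ≠ 0 := by
          rw [← abs_pos, heq]
          exact mul_pos hE (hpos y hy)
        have h1 : ContinuousAt (fun z : ℝ × ℝ => z.1 * Q.eval z.2 ^ 2) ((0 : ℝ), y) := by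
          fun_prop
        have h2 : ContinuousAt (fun z : ℝ × ℝ => 2 * (P.eval z.2 * Q.eval z.2))
            ((0 : ℝ), y) := by fun_prop
        have := h1.eventually_lt h2 (by
          have := mul_self_pos.mpr hne
          simp only [hQy, zero_mul]
          linarith)
        filter_upwards [this] with z hz hzK hz0
        exact (abs_sub_mul_lt hz0 hz).trans_le (hle _ hzK)
    filter_upwards [nhdsWithin_le_nhds key, self_mem_nhdsWithin] with ε h hε y hy
    exact h y hy hy hε
  obtain ⟨ε, hε⟩ := hev.exists
  obtain ⟨hm, hd⟩ := monic_add_and_natDegree hP.monic hP.natDegree_eq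
    (degree_C_mul_lt (r := -ε) hQd)
  have hmin := hP.norm_le _ hm hd
  obtain ⟨x, hx, hxe⟩ := exists_weightedNorm_eq hK hinf.nonempty hw hpos (P + C (-ε) * Q)
  rw [hxe, abs_div, abs_of_pos (hpos x hx), le_div_iff₀ (hpos x hx)] at hmin
  have := hε x hx
  simp only [eval_add, eval_mul, eval_C, neg_mul, ← sub_eq_add_neg] at hmin
  exact absurd hmin (not_le.mpr this)

theorem IsChebyshevPoly.eq (hK : IsCompact K) (hinf : K.Infinite)
    (hw : ContinuousOn w K) (hpos : ∀ x ∈ K, 0 < w x) {N : ℕ} {P₁ P₂ : ℝ[X]}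
    (h₁ : IsChebyshevPoly K w N P₁) (h₂ : IsChebyshevPoly K w N P₂) : P₁ = P₂ := by
  by_contra hne
  have hE : weightedNorm K w P₂ = weightedNorm K w P₁ :=
    le_antisymm (h₂.norm_le _ h₁.monic h₁.natDegree_eq) (h₁.norm_le _ h₂.monic h₂.natDegree_eq)
  have hlt := degree_sub_lt_of_monic h₂.monic h₁.monic h₂.natDegree_eq h₁.natDegree_eq
  obtain ⟨hm, hd⟩ := monic_add_and_natDegree h₁.monic h₁.natDegree_eq
    (degree_C_mul_lt (r := 1 / 2) hlt)
  set P := P₁ + C (1 / 2) * (P₂ - P₁) with hPdef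
  have hPx : ∀ x, P.eval x / w x = (P₁.eval x / w x + P₂.eval x / w x) / 2 := fun x => by
    simp only [hPdef, eval_add, eval_mul, eval_C, eval_sub]
    ring
  have hPn : weightedNorm K w P ≤ weightedNorm K w P₁ := by
    refine weightedNorm_le hinf.nonempty fun x hx => ?_
    have h1 := abs_le.mp (le_weightedNorm hK hw hpos P₁ hx)
    have h2 := abs_le.mp (le_weightedNorm hK hw hpos P₂ hx)
    rw [hE] at h2
    rw [hPx, abs_le]
    constructor <;> linarith
  have hPn' : weightedNorm K w P = weightedNorm K w P₁ := hPn.antisymm (h₁.norm_le _ hm hd)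
  have hP : IsChebyshevPoly K w N P :=
    ⟨hm, hd, fun P' hm' hd' => hPn.trans (h₁.norm_le _ hm' hd')⟩
  have hne' : P₂ - P₁ ≠ 0 := sub_ne_zero.mpr (Ne.symm hne)
  have hcard := hP.card_le_of_extremal hK hinf hw hpos (P₂ - P₁).roots.toFinset fun x hx he => by
    have h1 := abs_le.mp (le_weightedNorm hK hw hpos P₁ hx)
    have h2 := abs_le.mp (le_weightedNorm hK hw hpos P₂ hx)
    rw [hE] at h2
    rw [hPx, hPn'] at he
    -- Two numbers in `[-E, E]` whose mean is `±E` coincide.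
    have heq : P₁.eval x / w x = P₂.eval x / w x := by
      rcases abs_cases ((P₁.eval x / w x + P₂.eval x / w x) / 2) with ⟨h, _⟩ | ⟨h, _⟩ <;> linarith
    rw [div_left_inj' (hpos x hx).ne'] at heq
    simp [hne', heq]
  rw [degree_eq_natDegree hne', Nat.cast_lt] at hlt
  have := (Multiset.toFinset_card_le _).trans (card_roots' (P₂ - P₁))
  omega

end BestApproximation

/-! ### Weighted sums of squares on an arc of the circle -/

section ArcCone

/-- The trigonometric polynomial `cos (t + m) - cos h`, which is nonnegative exactly on the
translates by multiples of `2π` of the arc `|t + m| ≤ h`. -/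
noncomputable def arcFactor (m h t : ℝ) : ℝ := Real.cos (t + m) - Real.cos h

/-- The function `t ↦ |q (exp (i t))|²`. -/
noncomputable def circleNormSq (q : ℂ[X]) (t : ℝ) : ℝ := ‖q.eval (Complex.exp (t * Complex.I))‖ ^ 2

/-- The cone of the trigonometric polynomials `∑ |q|² + arcFactor * ∑ |r|²` with
`deg q ≤ d` and `deg r < d`. -/
noncomputable def arcCone (m h : ℝ) (d : ℕ) : AddSubmonoid (ℝ → ℝ) :=
  AddSubmonoid.closure
    ({F | ∃ q : ℂ[X], q.degree < ((d + 1 : ℕ) : WithBot ℕ) ∧ F = circleNormSq q} ∪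
     {F | ∃ q : ℂ[X], q.degree < (d : WithBot ℕ) ∧ F = arcFactor m h * circleNormSq q})

theorem circleNormSq_mul (p q : ℂ[X]) :
    circleNormSq (p * q) = circleNormSq p * circleNormSq q := by
  ext t
  simp [circleNormSq, mul_pow]

variable {m h : ℝ}

theorem circleNormSq_mem_arcCone {d : ℕ} {q : ℂ[X]} (hq : q.degree < ((d + 1 : ℕ) : WithBot ℕ)) :
    circleNormSq q ∈ arcCone m h d :=
  AddSubmonoid.subset_closure (Or.inl ⟨q, hq, rfl⟩)

theorem arcFactor_mul_circleNormSq_mem_arcCone {d : ℕ} {q : ℂ[X]}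
    (hq : q.degree < (d : WithBot ℕ)) : arcFactor m h * circleNormSq q ∈ arcCone m h d :=
  AddSubmonoid.subset_closure (Or.inr ⟨q, hq, rfl⟩)

theorem degree_mul_lt_of_lt {R : Type*} [Ring R] [IsDomain R] {p q : R[X]} {d e n : ℕ}
    (hp : p.degree < (d : WithBot ℕ)) (hq : q.degree < (e : WithBot ℕ)) (hn : d + e ≤ n + 1) :
    (p * q).degree < (n : WithBot ℕ) := by
  rcases eq_or_ne p 0 with rfl | hp0
  · simp
  rcases eq_or_ne q 0 with rfl | hq0
  · simp
  rw [← natDegree_lt_iff_degree_lt (by simpa using ⟨hp0, hq0⟩), natDegree_mul hp0 hq0]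
  rw [← natDegree_lt_iff_degree_lt hp0] at hp
  rw [← natDegree_lt_iff_degree_lt hq0] at hq
  omega

/-- Multiplying `cos (t + m) - u` by the unimodular `exp (i t)` turns it into a quadratic polynomial
in `exp (i t)`. -/
theorem exists_circleNormSq_eq_cos_sub_sq (m u : ℝ) :
    ∃ q : ℂ[X], q.degree < ((3 : ℕ) : WithBot ℕ) ∧
      (fun t => (Real.cos (t + m) - u) ^ 2) = circleNormSq q := by
  refine ⟨C (Complex.exp (m * Complex.I) / 2) * X ^ 2 + C (-(u : ℂ)) * X
    + C (Complex.exp (-(m * Complex.I)) / 2), degree_quadratic_lt, ?_⟩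
  ext t
  have hz : eval (Complex.exp (t * Complex.I)) (C (Complex.exp (m * Complex.I) / 2) * X ^ 2
      + C (-(u : ℂ)) * X + C (Complex.exp (-(m * Complex.I)) / 2))
      = Complex.exp (t * Complex.I) * (Real.cos (t + m) - u : ℝ) := by
    simp only [eval_add, eval_mul, eval_C, eval_pow, eval_X, Complex.ofReal_sub,
      Complex.ofReal_cos, Complex.ofReal_add]
    rw [Complex.cos.eq_1 (t + m), neg_mul, neg_mul, add_mul, neg_add, Complex.exp_add,
      Complex.exp_add]
    have : Complex.exp (t * Complex.I) * Complex.exp (-(t * Complex.I)) = 1 := by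
      rw [← Complex.exp_add]; simp
    linear_combination (-(1 / 2 : ℂ) * Complex.exp (-(m * Complex.I))) * this
  rw [circleNormSq, hz, norm_mul, Complex.norm_exp_ofReal_mul_I, one_mul, Complex.norm_real,
    Real.norm_eq_abs, sq_abs]

/-- On generators, the only case not immediate is the product of two weighted squares: there the
square of `arcFactor` is itself some `|r|²` with `deg r ≤ 2`, and the strict bounds on the two
weighted factors leave room for this degree. -/
theorem mul_mem_arcCone {d e : ℕ} {F G : ℝ → ℝ} (hF : F ∈ arcCone m h d)
    (hG : G ∈ arcCone m h e) : F * G ∈ arcCone m h (d + e) := by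
  induction hF using AddSubmonoid.closure_induction with
  | zero => simp
  | add x y _ _ hx hy => rw [add_mul]; exact add_mem hx hy
  | mem F hF =>
  induction hG using AddSubmonoid.closure_induction with
  | zero => simp
  | add x y _ _ hx hy => rw [mul_add]; exact add_mem hx hy
  | mem G hG =>
    rcases hF with ⟨p, hp, rfl⟩ | ⟨p, hp, rfl⟩ <;> rcases hG with ⟨q, hq, rfl⟩ | ⟨q, hq, rfl⟩
    · rw [← circleNormSq_mul]
      exact circleNormSq_mem_arcCone (degree_mul_lt_of_lt hp hq (by omega))
    · rw [mul_left_comm, ← circleNormSq_mul]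
      exact arcFactor_mul_circleNormSq_mem_arcCone (degree_mul_lt_of_lt hp hq (by omega))
    · rw [mul_assoc, ← circleNormSq_mul]
      exact arcFactor_mul_circleNormSq_mem_arcCone (degree_mul_lt_of_lt hp hq (by omega))
    · obtain ⟨r, hr, hr'⟩ := exists_circleNormSq_eq_cos_sub_sq m (Real.cos h)
      have hg : arcFactor m h * arcFactor m h = circleNormSq r := by
        rw [← hr']
        ext t
        exact (sq _).symm
      rw [mul_mul_mul_comm, hg, ← circleNormSq_mul, ← circleNormSq_mul]
      -- For `p ≠ 0` the bound forces `d ≥ 1`, so `d + e - 1` below is not truncated.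
      rcases eq_or_ne p 0 with rfl | hp0
      · exact circleNormSq_mem_arcCone (by simp)
      rw [← natDegree_lt_iff_degree_lt hp0] at hp
      exact circleNormSq_mem_arcCone
        (degree_mul_lt_of_lt hr (degree_mul_lt_of_lt (n := d + e - 1)
          (degree_le_natDegree.trans_lt (Nat.cast_lt.mpr hp)) hq (by omega)) (by omega))

theorem arcCone_mono {d e : ℕ} (hde : d ≤ e) : arcCone m h d ≤ arcCone m h e := by
  refine AddSubmonoid.closure_mono (Set.union_subset_union ?_ ?_) <;> rintro _ ⟨q, hq, rfl⟩ <;>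
    exact ⟨q, hq.trans_le (by exact_mod_cast (by omega)), rfl⟩

theorem const_mem_arcCone {r : ℝ} (hr : 0 ≤ r) (d : ℕ) : (fun _ => r) ∈ arcCone m h d := by
  have : (fun _ => r) = circleNormSq (C (Real.sqrt r : ℂ)) := by
    ext t
    simp [circleNormSq, Real.sq_sqrt hr]
  rw [this]
  exact circleNormSq_mem_arcCone (degree_C_le.trans_lt (by exact_mod_cast d.succ_pos))

theorem smul_mem_arcCone {r : ℝ} (hr : 0 ≤ r) {d : ℕ} {F : ℝ → ℝ} (hF : F ∈ arcCone m h d) :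
    (fun t => r * F t) ∈ arcCone m h d := by
  have := mul_mem_arcCone (const_mem_arcCone hr 0) hF
  rwa [zero_add] at this

theorem one_sub_cos_mem_arcCone (φ : ℝ) : (fun t => 1 - Real.cos (t + φ)) ∈ arcCone m h 1 := by
  have hq : circleNormSq (C (Complex.exp (φ * Complex.I)) * X + C (-1)) ∈ arcCone m h 1 :=
    circleNormSq_mem_arcCone degree_linear_lt
  convert smul_mem_arcCone (r := 1 / 2) (by norm_num) hq using 2 with t
  have hz : eval (Complex.exp (t * Complex.I)) (C (Complex.exp (φ * Complex.I)) * X + C (-1))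
      = (Real.cos (t + φ) - 1 : ℝ) + (Real.sin (t + φ) : ℝ) * Complex.I := by
    simp only [eval_add, eval_mul, eval_C, eval_X]
    rw [← Complex.exp_add, ← add_mul, ← Complex.ofReal_add, Complex.exp_mul_I, add_comm φ t]
    push_cast
    ring
  rw [circleNormSq, hz, ← Complex.normSq_eq_norm_sq, Complex.normSq_add_mul_I]
  linear_combination (-1 / 2 : ℝ) * Real.sin_sq_add_cos_sq (t + φ)

theorem arcFactor_mem_arcCone : arcFactor m h ∈ arcCone m h 1 := by
  have : arcFactor m h * circleNormSq 1 ∈ arcCone m h 1 :=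
    arcFactor_mul_circleNormSq_mem_arcCone (by rw [degree_one]; exact_mod_cast one_pos)
  convert this using 1
  ext t
  simp [circleNormSq]

/-- In the span of `1`, `cos t`, `sin t`, the functions vanishing at the endpoint `t = -(m + h)`
form a plane, spanned by `1 - cos (t + m + h)` and `arcFactor`. The coefficients `sin m / sin h` and
`sin (m + h) / sin h` are nonnegative. -/
theorem cos_sub_left_mem_arcCone (hm : 0 ≤ Real.sin m) (hh : 0 < Real.sin h)
    (hmh : 0 ≤ Real.sin (m + h)) :
    (fun t => Real.cos t - Real.cos (m + h)) ∈ arcCone m h 1 := by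
  have := add_mem
    (smul_mem_arcCone (div_nonneg hm hh.le) (one_sub_cos_mem_arcCone (m := m) (h := h) (m + h)))
    (smul_mem_arcCone (div_nonneg hmh hh.le) (arcFactor_mem_arcCone (m := m) (h := h)))
  convert this using 1
  ext t
  simp only [Pi.add_apply, arcFactor]
  field_simp
  simp only [Real.cos_add, Real.sin_add]
  have h1 := Real.sin_sq_add_cos_sq m
  have h2 := Real.sin_sq_add_cos_sq h
  linear_combination (-(Real.sin h * Real.cos t)) * h1 + Real.sin m * h2

theorem right_sub_cos_mem_arcCone (hm : 0 ≤ Real.sin m) (hh : 0 < Real.sin h)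
    (hmh : 0 ≤ Real.sin (m - h)) :
    (fun t => Real.cos (m - h) - Real.cos t) ∈ arcCone m h 1 := by
  have := add_mem
    (smul_mem_arcCone (div_nonneg hm hh.le) (one_sub_cos_mem_arcCone (m := m) (h := h) (m - h)))
    (smul_mem_arcCone (div_nonneg hmh hh.le) (arcFactor_mem_arcCone (m := m) (h := h)))
  convert this using 1
  ext t
  simp only [Pi.add_apply, arcFactor]
  field_simp
  simp only [Real.cos_add, Real.cos_sub, Real.sin_sub]
  have h1 := Real.sin_sq_add_cos_sq m
  have h2 := Real.sin_sq_add_cos_sq h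
  linear_combination (Real.sin h * Real.cos t) * h1 + Real.sin m * h2

theorem cos_sub_sq_mem_arcCone (u : ℝ) : (fun t => (Real.cos t - u) ^ 2) ∈ arcCone m h 2 := by
  obtain ⟨q, hq, hqe⟩ := exists_circleNormSq_eq_cos_sub_sq 0 u
  simp only [add_zero] at hqe
  rw [hqe]
  exact circleNormSq_mem_arcCone hq

/-- If `f` were negative somewhere it would be so at infinitely many points of the interval, all of
them zeros of `g`. This lets a nonnegative factor be cancelled. -/
theorem eval_nonneg_of_mul_nonneg {a b : ℝ} (hab : a < b) {g f : ℝ[X]} (hg : g ≠ 0)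
    (hgn : ∀ x ∈ Set.Icc a b, 0 ≤ g.eval x)
    (hf : ∀ x ∈ Set.Icc a b, 0 ≤ (g * f).eval x) : ∀ x ∈ Set.Icc a b, 0 ≤ f.eval x := by
  by_contra! hneg
  obtain ⟨x₀, hx₀, hlt⟩ := hneg
  have hev : ∀ᶠ x in nhdsWithin x₀ (Set.Icc a b), f.eval x < 0 :=
    nhdsWithin_le_nhds (f.continuous.continuousAt.eventually_lt continuousAt_const hlt)
  obtain ⟨ε, hε, hsub⟩ := Metric.mem_nhdsWithin_iff.mp hev
  have hinf : (Metric.ball x₀ ε ∩ Set.Icc a b).Infinite := by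
    rw [Real.ball_eq_Ioo]
    have h1 : max (x₀ - ε) a < min (x₀ + ε) b := by
      rw [max_lt_iff, lt_min_iff, lt_min_iff]
      exact ⟨⟨by linarith, by linarith [hx₀.1, hx₀.2]⟩, by linarith [hx₀.1], hab⟩
    refine (Set.Ioo_infinite h1).mono fun x hx => ?_
    have h2 := max_lt_iff.mp hx.1
    have h3 := lt_min_iff.mp hx.2
    exact ⟨⟨h2.1, h3.1⟩, h2.2.le, h3.2.le⟩
  refine hg (eq_zero_of_infinite_isRoot g (hinf.mono fun x hx => ?_))
  have h1 : f.eval x < 0 := hsub hx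
  have h2 := hf x hx.2
  rw [eval_mul] at h2
  have h3 := hgn x hx.2
  exact le_antisymm (by nlinarith) h3

/-- Induction on the degree, splitting off at a complex root a factor that is nonnegative on the
interval: linear for a real root outside its interior, `(X - r) ^ 2` for an interior root, a sum of
two squares for a nonreal root. -/
theorem eval_cos_mem_arcCone (hm : 0 ≤ Real.sin m) (hh : 0 < Real.sin h)
    (hl : 0 ≤ Real.sin (m + h)) (hr : 0 ≤ Real.sin (m - h))
    (hlr : Real.cos (m + h) < Real.cos (m - h)) (f : ℝ[X])
    (hf : ∀ x ∈ Set.Icc (Real.cos (m + h)) (Real.cos (m - h)), 0 ≤ f.eval x) :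
    (fun t => f.eval (Real.cos t)) ∈ arcCone m h f.natDegree := by
  induction hn : f.natDegree using Nat.strong_induction_on generalizing f with
  | _ n ih =>
  have step : ∀ (g k : ℝ[X]), f = g * k → 0 < g.natDegree →
      (∀ x ∈ Set.Icc (Real.cos (m + h)) (Real.cos (m - h)), 0 ≤ g.eval x) →
      (fun t => g.eval (Real.cos t)) ∈ arcCone m h g.natDegree →
      (fun t => f.eval (Real.cos t)) ∈ arcCone m h n := by
    intro g k hfgk hg hgn hgm
    rcases eq_or_ne k 0 with rfl | hk
    · simpa [hfgk] using const_mem_arcCone (m := m) (h := h) le_rfl n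
    have hg0 : g ≠ 0 := ne_zero_of_natDegree_gt hg
    have hdeg : n = g.natDegree + k.natDegree := by
      rw [← hn, hfgk, natDegree_mul hg0 hk]
    have hkm := ih k.natDegree (by omega) k
      (eval_nonneg_of_mul_nonneg hlr hg0 hgn (hfgk ▸ hf)) rfl
    have := mul_mem_arcCone hgm hkm
    rw [← hdeg] at this
    convert this using 1
    ext t
    simp [hfgk]
  rcases Nat.eq_zero_or_pos n with rfl | hpos
  · obtain ⟨r, rfl⟩ := natDegree_eq_zero.mp hn
    simpa using const_mem_arcCone (by simpa using hf _ (Set.left_mem_Icc.mpr hlr.le)) 0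
  obtain ⟨z, hz⟩ := IsAlgClosed.exists_aeval_eq_zero ℂ f
    (natDegree_pos_iff_degree_pos.mp (hn ▸ hpos)).ne'
  by_cases hzi : z.im = 0
  · obtain ⟨r, rfl⟩ : ∃ r : ℝ, z = r := ⟨z.re, Complex.ext rfl (by simpa using hzi)⟩
    have hroot : f.IsRoot r := by
      have : aeval (algebraMap ℝ ℂ r) f = 0 := hz
      rw [aeval_algebraMap_apply] at this
      exact (algebraMap ℝ ℂ).injective (by simpa using this)
    obtain ⟨k, hk⟩ := dvd_iff_isRoot.mpr hroot
    rcases le_or_gt r (Real.cos (m + h)) with hrl | hrl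
    · refine step (X - C r) k hk (by simp) (fun x hx => by simpa using hrl.trans hx.1) ?_
      rw [natDegree_X_sub_C]
      convert add_mem (cos_sub_left_mem_arcCone hm hh hl) (const_mem_arcCone (sub_nonneg.mpr hrl) 1)
        using 1
      ext t
      simp
    rcases le_or_gt (Real.cos (m - h)) r with hrr | hrr
    · have hX : (C r - X : ℝ[X]) = -(X - C r) := by ring
      refine step (C r - X) (-k) (by rw [hk]; ring) (by rw [hX, natDegree_neg]; simp)
        (fun x hx => by simpa using hx.2.trans hrr) ?_
      rw [hX, natDegree_neg, natDegree_X_sub_C]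
      convert add_mem (right_sub_cos_mem_arcCone hm hh hr)
        (const_mem_arcCone (sub_nonneg.mpr hrr) 1) using 1
      ext t
      simp
    -- At an interior root the cofactor `k` is nonnegative to the right of `r` and nonpositive to
    -- the left, so `k` vanishes at `r` and the root is at least double.
    · have h1 := eval_nonneg_of_mul_nonneg hrr (X_sub_C_ne_zero r)
        (fun x hx => by simpa using hx.1) (fun x hx => hk ▸ hf x ⟨hrl.le.trans hx.1, hx.2⟩)
        r (Set.left_mem_Icc.mpr hrr.le)
      have h2 := eval_nonneg_of_mul_nonneg (f := -k) hrl (neg_ne_zero.mpr (X_sub_C_ne_zero r))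
        (fun x hx => by simpa using hx.2)
        (fun x hx => by rw [neg_mul_neg]; exact hk ▸ hf x ⟨hx.1, hx.2.trans hrr.le⟩)
        r (Set.right_mem_Icc.mpr hrl.le)
      rw [eval_neg] at h2
      obtain ⟨k', hk'⟩ := dvd_iff_isRoot.mpr (show k.IsRoot r by
        rw [IsRoot.def]; linarith)
      have hd : ((X - C r) ^ 2).natDegree = 2 := by simp
      refine step ((X - C r) ^ 2) k' (by rw [hk, hk']; ring) (by simp)
        (fun x _ => by simpa using sq_nonneg (x - r)) ?_
      rw [hd]
      simpa using cos_sub_sq_mem_arcCone r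
  · obtain ⟨k, hk⟩ := quadratic_dvd_of_aeval_eq_zero_im_ne_zero f hz hzi
    have hd : (X ^ 2 - C (2 * z.re) * X + C (‖z‖ ^ 2) : ℝ[X]).natDegree = 2 := by
      compute_degree!
    have he : ∀ x, (X ^ 2 - C (2 * z.re) * X + C (‖z‖ ^ 2) : ℝ[X]).eval x
        = (x - z.re) ^ 2 + z.im ^ 2 := fun x => by
      simp only [eval_add, eval_sub, eval_mul, eval_pow, eval_X, eval_C]
      rw [← Complex.normSq_eq_norm_sq, Complex.normSq_apply]
      ring
    refine step _ k hk (by rw [hd]; norm_num) (fun x _ => by rw [he]; positivity) ?_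
    rw [hd]
    simp only [he]
    exact add_mem (cos_sub_sq_mem_arcCone z.re) (const_mem_arcCone (sq_nonneg z.im) 2)

end ArcCone

/-! ### Gram matrices and Laurent polynomials on the circle -/

section Gram

/-- The Laurent polynomial whose coefficients are the diagonal sums of `A`. -/
noncomputable def gram {d : ℕ} (A : Matrix (Fin d) (Fin d) ℂ) (z : ℂ) : ℂ :=
  ∑ i : Fin d, ∑ j : Fin d, A i j * z ^ ((i : ℤ) - (j : ℤ))

theorem gram_zero {d : ℕ} (z : ℂ) : gram (0 : Matrix (Fin d) (Fin d) ℂ) z = 0 := by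
  simp [gram]

theorem gram_add {d : ℕ} (A B : Matrix (Fin d) (Fin d) ℂ) (z : ℂ) :
    gram (A + B) z = gram A z + gram B z := by
  simp [gram, add_mul, Finset.sum_add_distrib]

theorem zpow_sub_eq_mul_star {z : ℂ} (hz : ‖z‖ = 1) (i j : ℕ) :
    z ^ ((i : ℤ) - (j : ℤ)) = z ^ i * star (z ^ j) := by
  have hz0 : z ≠ 0 := norm_ne_zero_iff.mp (by rw [hz]; exact one_ne_zero)
  rw [zpow_sub₀ hz0, zpow_natCast, zpow_natCast, div_eq_mul_inv, star_pow, ← inv_pow]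
  congr 2
  exact Complex.inv_eq_conj hz

theorem gram_nonneg {d : ℕ} {A : Matrix (Fin d) (Fin d) ℂ} (hA : A.PosSemidef) {z : ℂ}
    (hz : ‖z‖ = 1) : 0 ≤ gram A z := by
  have := hA.dotProduct_mulVec_nonneg fun j : Fin d => star (z ^ (j : ℕ))
  convert this using 1
  simp only [gram, dotProduct, Matrix.mulVec, Pi.star_apply, star_star, Finset.mul_sum]
  refine Finset.sum_congr rfl fun i _ => Finset.sum_congr rfl fun j _ => ?_
  rw [zpow_sub_eq_mul_star hz]
  ring

/-- The witness is the rank-one matrix of the coefficient vector of `q`. -/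
theorem exists_gram_eq_circleNormSq {d : ℕ} {q : ℂ[X]} (hq : q.degree < (d : WithBot ℕ)) :
    ∃ A : Matrix (Fin d) (Fin d) ℂ, A.PosSemidef ∧
      ∀ t : ℝ, gram A (Complex.exp (t * Complex.I)) = circleNormSq q t := by
  refine ⟨_, Matrix.posSemidef_vecMulVec_self_star fun i : Fin d => q.coeff i, fun t => ?_⟩
  set z := Complex.exp (t * Complex.I)
  have hz : ‖z‖ = 1 := Complex.norm_exp_ofReal_mul_I t
  have hev : q.eval z = ∑ i : Fin d, q.coeff i * z ^ (i : ℕ) := by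
    rcases eq_or_ne q 0 with rfl | hq0
    · simp
    rw [eval_eq_sum_range' ((natDegree_lt_iff_degree_lt hq0).mpr hq),
      Finset.sum_range (fun i => q.coeff i * z ^ i)]
  rw [circleNormSq, Complex.ofReal_pow, ← Complex.mul_conj', hev, map_sum, Finset.sum_mul_sum]
  refine Finset.sum_congr rfl fun i _ => Finset.sum_congr rfl fun j _ => ?_
  rw [zpow_sub_eq_mul_star hz, Matrix.vecMulVec_apply, Pi.star_apply, map_mul]
  simp only [starRingEnd_apply]
  ring

theorem exists_gram_of_mem_arcCone {m h : ℝ} {d : ℕ} {F : ℝ → ℝ} (hF : F ∈ arcCone m h d) :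
    ∃ (Q : Matrix (Fin (d + 1)) (Fin (d + 1)) ℂ) (R : Matrix (Fin d) (Fin d) ℂ),
      Q.PosSemidef ∧ R.PosSemidef ∧ ∀ t : ℝ, (F t : ℂ) =
        gram Q (Complex.exp (t * Complex.I)) +
          arcFactor m h t * gram R (Complex.exp (t * Complex.I)) := by
  induction hF using AddSubmonoid.closure_induction with
  | zero => exact ⟨0, 0, .zero, .zero, fun t => by simp [gram_zero]⟩
  | add F G _ _ hF hG =>
    obtain ⟨Q, R, hQ, hR, h⟩ := hF
    obtain ⟨Q', R', hQ', hR', h'⟩ := hG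
    refine ⟨Q + Q', R + R', hQ.add hQ', hR.add hR', fun t => ?_⟩
    rw [Pi.add_apply, Complex.ofReal_add, h, h', gram_add, gram_add]
    ring
  | mem F hF =>
    rcases hF with ⟨q, hq, rfl⟩ | ⟨q, hq, rfl⟩ <;>
      obtain ⟨A, hA, h⟩ := exists_gram_eq_circleNormSq hq
    · exact ⟨A, 0, hA, .zero, fun t => by rw [h, gram_zero, mul_zero, add_zero]⟩
    · refine ⟨0, A, .zero, hA, fun t => ?_⟩
      rw [h, gram_zero, zero_add, Pi.mul_apply, Complex.ofReal_mul]

/-- Multiplication by `z ^ e` shifts the diagonals; the size condition keeps every exponent in `[-M,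
M]`. It holds with equality for `Q` at `e = 0` and for `R`, one row smaller, at `e = ±1`. -/
theorem sum_diagSum_mul_zpow {d M : ℕ} (A : Matrix (Fin d) (Fin d) ℂ) (e : ℤ)
    (h : d + |e| ≤ M + 1) {z : ℂ} (hz : z ≠ 0) :
    ∑ k ∈ Finset.Icc (-M : ℤ) M, diagSum A (k - e) * z ^ k = z ^ e * gram A z := by
  simp only [diagSum, gram, Finset.sum_mul, Finset.mul_sum]
  rw [Finset.sum_comm]
  refine Finset.sum_congr rfl fun i _ => ?_
  rw [Finset.sum_comm]
  refine Finset.sum_congr rfl fun j _ => ?_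
  rw [Finset.sum_eq_single ((i : ℤ) - j + e)]
  · rw [if_pos (by ring), zpow_add₀ hz]
    ring
  · intro k _ hk
    rw [if_neg (by omega), zero_mul]
  · intro hk
    exfalso
    rw [Finset.mem_Icc] at hk
    have h1 := i.2
    have h2 := j.2
    have h3 := abs_le.mp (le_refl |e|)
    omega

theorem diagSum_neg {d : ℕ} {A : Matrix (Fin d) (Fin d) ℂ} (hA : A.IsHermitian) (k : ℤ) :
    diagSum A (-k) = star (diagSum A k) := by
  simp only [diagSum, star_sum]
  rw [Finset.sum_comm]
  refine Finset.sum_congr rfl fun i _ => Finset.sum_congr rfl fun j _ => ?_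
  rw [apply_ite star, star_zero, hA.apply]
  exact if_congr (by omega) rfl rfl

theorem eq_zero_of_sum_zpow_eq_zero {M : ℕ} {u : ℤ → ℂ}
    (h : ∀ t : ℝ, ∑ k ∈ Finset.Icc (-M : ℤ) M, u k * Complex.exp (t * Complex.I) ^ k = 0)
    {k : ℤ} (hk : k ∈ Finset.Icc (-M : ℤ) M) : u k = 0 := by
  set p : ℂ[X] := ∑ k ∈ Finset.Icc (-M : ℤ) M, C (u k) * X ^ (k + M).toNat with hp
  have hp0 : p = 0 := by
    refine eq_zero_of_infinite_isRoot p (Set.Infinite.mono (s := Set.range fun t : ℝ =>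
      Complex.exp (t * Complex.I)) ?_ ?_)
    · rintro _ ⟨t, rfl⟩
      have hz := Complex.exp_ne_zero (t * Complex.I)
      rw [Set.mem_ofPred_eq, IsRoot.def, hp, eval_finsetSum]
      rw [← mul_zero (Complex.exp (t * Complex.I) ^ (M : ℤ)), ← h t, Finset.mul_sum]
      refine Finset.sum_congr rfl fun k hk => ?_
      rw [Finset.mem_Icc] at hk
      simp only [eval_mul, eval_C, eval_pow, eval_X]
      rw [← zpow_natCast, Int.toNat_of_nonneg (by omega), zpow_add₀ hz]
      ring
    -- The circle is infinite, as its real parts fill `[-1, 1]`.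
    · refine Set.Infinite.of_image Complex.re
        ((Set.Icc_infinite (show (-1 : ℝ) < 1 by norm_num)).mono fun x hx => ?_)
      refine ⟨_, ⟨Real.arccos x, rfl⟩, ?_⟩
      rw [Complex.exp_ofReal_mul_I_re, Real.cos_arccos hx.1 hx.2]
  have hc : p.coeff (k + M).toNat = u k := by
    rw [hp, finsetSum_coeff, Finset.sum_eq_single k]
    · simp
    · intro l hl hlk
      rw [Finset.mem_Icc] at hl hk
      rw [coeff_C_mul, coeff_X_pow, if_neg (by omega), mul_zero]
    · exact fun h => absurd hk h
  rw [← hc, hp0, coeff_zero]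

end Gram

/-! ### Chebyshev coefficients as Fourier coefficients -/

section ChebyshevCoefficients

theorem chebBasis_repr_T (n : ℕ) : chebBasis.repr (Chebyshev.T ℝ n) = Finsupp.single n 1 := by
  rw [← chebBasis_apply, Module.Basis.repr_self]

theorem chebCoeff_add (P Q : ℝ[X]) (m : ℕ) :
    chebCoeff (P + Q) m = chebCoeff P m + chebCoeff Q m := by
  simp [chebCoeff]

theorem chebCoeff_C_mul (r : ℝ) (P : ℝ[X]) (m : ℕ) :
    chebCoeff (C r * P) m = r * chebCoeff P m := by
  rw [← smul_eq_C_mul]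
  simp [chebCoeff]

theorem chebCoeff_eq_zero {P : ℝ[X]} {m : ℕ} (hm : P.natDegree < m) : chebCoeff P m = 0 := by
  have hP : P ∈ degreeLT ℝ m :=
    mem_degreeLT.mpr (degree_le_natDegree.trans_lt (Nat.cast_lt.mpr hm))
  rw [← chebSequence.span_degreeLT fun i _ =>
    (leadingCoeff_ne_zero.mpr (chebSequence.ne_zero i)).isUnit] at hP
  clear hm
  induction hP using Submodule.span_induction with
  | zero => simp [chebCoeff]
  | add P Q _ _ hP hQ => rw [chebCoeff_add, hP, hQ, add_zero]
  | smul r P _ hP => rw [smul_eq_C_mul, chebCoeff_C_mul, hP, mul_zero]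
  | mem P hP =>
    obtain ⟨i, hi, rfl⟩ := hP
    change chebBasis.repr (chebSequence i) m = 0
    rw [show chebSequence i = Chebyshev.T ℝ i from rfl, chebBasis_repr_T,
      Finsupp.single_eq_of_ne (ne_of_gt hi)]

theorem eq_sum_chebCoeff {P : ℝ[X]} {M : ℕ} (hM : P.natDegree ≤ M) :
    P = ∑ m ∈ Finset.range (M + 1), chebCoeff P m • Chebyshev.T ℝ m := by
  conv_lhs => rw [← chebBasis.linearCombination_repr P, Finsupp.linearCombination_apply]
  rw [Finsupp.sum_of_support_subset _ (s := Finset.range (M + 1))]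
  · simp [chebBasis_apply, chebCoeff]
  · intro m hm
    rw [Finset.mem_range]
    by_contra! hlt
    exact Finsupp.mem_support_iff.mp hm (chebCoeff_eq_zero (by omega))
  · simp

/-- The `k`-th Fourier coefficient of `t ↦ P (cos t)`. -/
noncomputable def cosCoeff (P : ℝ[X]) (k : ℤ) : ℝ :=
  (if k = 0 then 1 else 1 / 2) * chebCoeff P k.natAbs

theorem sum_Icc_neg_succ (u : ℤ → ℂ) (M : ℕ) :
    ∑ k ∈ Finset.Icc (-(M + 1 : ℕ) : ℤ) (M + 1 : ℕ), u k
      = ∑ k ∈ Finset.Icc (-M : ℤ) M, u k + (u (M + 1 : ℕ) + u (-(M + 1 : ℕ))) := by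
  have : Finset.Icc (-(M + 1 : ℕ) : ℤ) (M + 1 : ℕ)
      = insert (-(M + 1 : ℕ) : ℤ) (insert ((M + 1 : ℕ) : ℤ) (Finset.Icc (-M : ℤ) M)) := by
    ext k
    simp only [Finset.mem_insert, Finset.mem_Icc]
    omega
  rw [this, Finset.sum_insert, Finset.sum_insert]
  · ring
  · simp only [Finset.mem_Icc]; omega
  · simp only [Finset.mem_insert, Finset.mem_Icc]; omega

theorem eval_cos_eq_sum {P : ℝ[X]} {M : ℕ} (hM : P.natDegree ≤ M) (t : ℝ) :
    ((P.eval (Real.cos t) : ℝ) : ℂ)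
      = ∑ k ∈ Finset.Icc (-M : ℤ) M, (cosCoeff P k : ℂ) * Complex.exp (t * Complex.I) ^ k := by
  conv_lhs => rw [eq_sum_chebCoeff hM]
  clear hM
  induction M with
  | zero => simp [cosCoeff]
  | succ M ih =>
    rw [sum_Icc_neg_succ, ← ih, Finset.sum_range_succ, eval_add, Complex.ofReal_add]
    congr 1
    have h0 : (-((M + 1 : ℕ) : ℤ)) ≠ 0 := by omega
    have h1 : (((M + 1 : ℕ) : ℤ)) ≠ 0 := by omega
    rw [eval_smul, Chebyshev.T_real_cos, cosCoeff, cosCoeff, if_neg h0, if_neg h1, Int.natAbs_neg,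
      Int.natAbs_natCast, ← Complex.exp_int_mul, ← Complex.exp_int_mul, smul_eq_mul,
      Complex.ofReal_mul, Complex.ofReal_cos, Complex.cos]
    push_cast
    ring_nf

end ChebyshevCoefficients

/-! ### Nonnegativity on one interval as a semidefinite constraint -/

section IntervalCertificate

variable {a b : ℝ}

theorem cos_add_half_arccos (ha : -1 ≤ a) (ha' : a ≤ 1) :
    Real.cos ((Real.arccos a + Real.arccos b) / 2 + (Real.arccos a - Real.arccos b) / 2) = a := by
  rw [← add_div, add_add_sub_cancel, add_self_div_two, Real.cos_arccos ha ha']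

theorem cos_sub_half_arccos (hb : -1 ≤ b) (hb' : b ≤ 1) :
    Real.cos ((Real.arccos a + Real.arccos b) / 2 - (Real.arccos a - Real.arccos b) / 2) = b := by
  rw [← sub_div, add_sub_sub_cancel, add_self_div_two, Real.cos_arccos hb hb']

theorem alpha_mul_sub_beta_add (a b t : ℝ) :
    alpha a b * Complex.exp (t * Complex.I) - (beta a b : ℂ)
      + star (alpha a b) * (Complex.exp (t * Complex.I))⁻¹
      = (arcFactor ((Real.arccos a + Real.arccos b) / 2) ((Real.arccos a - Real.arccos b) / 2) t
          : ℝ) := by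
  have hα : alpha a b
      = 1 / 2 * Complex.exp (((Real.arccos a + Real.arccos b) / 2 : ℝ) * Complex.I) := by
    rw [alpha]
    congr 2
    push_cast
    ring
  have hβ : beta a b = Real.cos ((Real.arccos a - Real.arccos b) / 2) := by
    rw [beta]
    ring_nf
  rw [hα, hβ, arcFactor]
  set m := (Real.arccos a + Real.arccos b) / 2
  rw [star_mul, ← starRingEnd_apply, ← starRingEnd_apply, ← Complex.exp_conj, map_mul,
    Complex.conj_ofReal, Complex.conj_I, ← Complex.exp_neg, Complex.ofReal_sub,
    Complex.ofReal_cos (t + m), Complex.cos, Complex.ofReal_add, neg_mul, add_mul, neg_add,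
    Complex.exp_add, Complex.exp_add]
  simp only [map_div₀, map_one, map_ofNat, mul_neg]
  ring

/-- The lift `t = -arccos x` has the sign that puts `t + m` in `[-h, h]`. -/
theorem arcFactor_nonneg {x : ℝ} (hx : x ∈ Set.Icc a b) :
    0 ≤ arcFactor ((Real.arccos a + Real.arccos b) / 2) ((Real.arccos a - Real.arccos b) / 2)
      (-Real.arccos x) := by
  have h1 := Real.arccos_le_arccos hx.1
  have h2 := Real.arccos_le_arccos hx.2
  have h3 := Real.arccos_le_pi a
  have h4 := Real.arccos_nonneg b
  rw [arcFactor, sub_nonneg, ← Real.cos_abs (-Real.arccos x + _)]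
  refine Real.cos_le_cos_of_nonneg_of_le_pi (abs_nonneg _) (by linarith [Real.pi_pos]) ?_
  rw [abs_le]
  constructor <;> linarith

/-- Both sides are trigonometric polynomials of degree at most `M`, and the constraints equate their
coefficients. Frequencies `m ≥ 0` suffice: by Hermitian symmetry the coefficients at `-k` are
conjugate to those at `k`. -/
theorem linear_constraint_iff {M : ℕ} {Q : Matrix (Fin (M + 1)) (Fin (M + 1)) ℂ}
    {R : Matrix (Fin M) (Fin M) ℂ} (hQ : Q.IsHermitian) (hR : R.IsHermitian) {f : ℝ[X]}
    (hf : f.natDegree ≤ M) (a b : ℝ) :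
    (∀ m : Fin (M + 1), diagSum Q (m : ℤ) + alpha a b * diagSum R ((m : ℤ) - 1)
        - (beta a b : ℂ) * diagSum R (m : ℤ) + star (alpha a b) * diagSum R ((m : ℤ) + 1)
        = (cosCoeff f m : ℂ)) ↔
      ∀ t : ℝ, ((f.eval (Real.cos t) : ℝ) : ℂ) = gram Q (Complex.exp (t * Complex.I))
        + arcFactor ((Real.arccos a + Real.arccos b) / 2) ((Real.arccos a - Real.arccos b) / 2) t
          * gram R (Complex.exp (t * Complex.I)) := by
  set u : ℤ → ℂ := fun k => diagSum Q k + alpha a b * diagSum R (k - 1)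
        - (beta a b : ℂ) * diagSum R k + star (alpha a b) * diagSum R (k + 1) with hu
  have husum : ∀ t : ℝ, ∑ k ∈ Finset.Icc (-M : ℤ) M, u k * Complex.exp (t * Complex.I) ^ k
      = gram Q (Complex.exp (t * Complex.I))
        + arcFactor ((Real.arccos a + Real.arccos b) / 2) ((Real.arccos a - Real.arccos b) / 2) t
          * gram R (Complex.exp (t * Complex.I)) := by
    intro t
    have hz := Complex.exp_ne_zero (t * Complex.I)
    have e0 := sum_diagSum_mul_zpow (M := M) Q 0 (by simp) hz
    have e1 := sum_diagSum_mul_zpow (M := M) R 0 (by simp) hz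
    have e2 := sum_diagSum_mul_zpow (M := M) R 1 (by simp) hz
    have e3 := sum_diagSum_mul_zpow (M := M) R (-1) (by simp) hz
    simp only [sub_zero, zpow_zero, one_mul, zpow_one, zpow_neg_one, sub_neg_eq_add] at e0 e1 e2 e3
    rw [← alpha_mul_sub_beta_add]
    simp only [hu, add_mul, sub_mul, Finset.sum_add_distrib, Finset.sum_sub_distrib, mul_assoc,
      ← Finset.mul_sum]
    rw [e0, e1, e2, e3]
    ring
  have huneg : ∀ k, u (-k) = star (u k) := by
    intro k
    have h1 : -k - 1 = -(k + 1) := by ring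
    have h2 : -k + 1 = -(k - 1) := by ring
    have hβ : star (beta a b : ℂ) = (beta a b : ℂ) := Complex.conj_ofReal _
    simp only [hu, h1, h2, diagSum_neg hQ, diagSum_neg hR, star_add, star_sub, star_mul', star_star,
      hβ]
    ring
  have hcneg : ∀ k, cosCoeff f (-k) = cosCoeff f k := fun k => by simp [cosCoeff]
  constructor
  · intro h t
    rw [← husum, eval_cos_eq_sum hf]
    refine Finset.sum_congr rfl fun k hk => ?_
    rw [Finset.mem_Icc] at hk
    congr 1
    rcases le_total 0 k with h0 | h0
    · lift k to ℕ using h0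
      exact (h ⟨k, by omega⟩).symm
    · obtain ⟨n, rfl⟩ := Int.exists_eq_neg_ofNat h0
      rw [huneg, hcneg, show u n = _ from h ⟨n, by omega⟩]
      exact (Complex.conj_ofReal _).symm
  · intro h m
    have := eq_zero_of_sum_zpow_eq_zero (M := M) (u := fun k => u k - (cosCoeff f k : ℂ))
      (fun t => by
        simp only [sub_mul, Finset.sum_sub_distrib]
        rw [husum, ← eval_cos_eq_sum hf, h, sub_self]) (k := (m : ℤ))
      (Finset.mem_Icc.mpr (by omega))
    exact sub_eq_zero.mp this

theorem exists_linear_constraint_iff {M : ℕ} {f : ℝ[X]} (hf : f.natDegree ≤ M) (ha : -1 ≤ a)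
    (hab : a < b) (hb : b ≤ 1) :
    (∃ (Q : Matrix (Fin (M + 1)) (Fin (M + 1)) ℂ) (R : Matrix (Fin M) (Fin M) ℂ),
      Q.PosSemidef ∧ R.PosSemidef ∧
      ∀ m : Fin (M + 1), diagSum Q (m : ℤ) + alpha a b * diagSum R ((m : ℤ) - 1)
        - (beta a b : ℂ) * diagSum R (m : ℤ) + star (alpha a b) * diagSum R ((m : ℤ) + 1)
        = (cosCoeff f m : ℂ)) ↔ ∀ x ∈ Set.Icc a b, 0 ≤ f.eval x := by
  constructor
  · rintro ⟨Q, R, hQ, hR, h⟩ x hx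
    have := (linear_constraint_iff hQ.1 hR.1 hf a b).mp h (-Real.arccos x)
    rw [Real.cos_neg, Real.cos_arccos (ha.trans hx.1) (hx.2.trans hb)] at this
    have hz := Complex.norm_exp_ofReal_mul_I (-Real.arccos x)
    rw [← Complex.zero_le_real, this]
    exact add_nonneg (gram_nonneg hQ hz) (mul_nonneg
      (Complex.zero_le_real.mpr (arcFactor_nonneg hx)) (gram_nonneg hR hz))
  · intro h
    have h1 := Real.arccos_lt_arccos ha hab hb
    have h3 := Real.arccos_le_pi a
    have h4 := Real.arccos_nonneg b
    have hl := cos_add_half_arccos (b := b) ha (hab.le.trans hb)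
    have hr := cos_sub_half_arccos (a := a) (ha.trans hab.le) hb
    have hmem := eval_cos_mem_arcCone (m := (Real.arccos a + Real.arccos b) / 2)
      (h := (Real.arccos a - Real.arccos b) / 2)
      (Real.sin_nonneg_of_nonneg_of_le_pi (by linarith) (by linarith))
      (Real.sin_pos_of_pos_of_lt_pi (by linarith) (by linarith))
      (Real.sin_nonneg_of_nonneg_of_le_pi (by linarith) (by linarith))
      (Real.sin_nonneg_of_nonneg_of_le_pi (by linarith) (by linarith))
      (by rwa [hl, hr]) f (by rwa [hl, hr])
    obtain ⟨Q, R, hQ, hR, hQR⟩ := exists_gram_of_mem_arcCone (arcCone_mono hf hmem)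
    exact ⟨Q, R, hQ, hR, (linear_constraint_iff hQ.1 hR.1 hf a b).mpr hQR⟩

end IntervalCertificate

/-! ### Feasible points as bounds on the weighted norm -/

section Program

variable {N : ℕ}

theorem natDegree_chebSum_le (p : Fin (N + 1) → ℝ) : (chebSum p).natDegree ≤ N := by
  refine natDegree_sum_le_of_forall_le _ _ fun n _ => (natDegree_smul_le _ _).trans ?_
  rw [Chebyshev.natDegree_T, Int.natAbs_natCast]
  omega

theorem coeff_chebSum (p : Fin (N + 1) → ℝ) :
    (chebSum p).coeff N = p (Fin.last N) * 2 ^ (N - 1) := by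
  have hT : (Chebyshev.T ℝ N).coeff N = 2 ^ (N - 1) := by
    have := Chebyshev.leadingCoeff_T ℝ N
    rwa [leadingCoeff, Chebyshev.natDegree_T, Int.natAbs_natCast] at this
  rw [chebSum, finsetSum_coeff, Fin.sum_univ_castSucc, Finset.sum_eq_zero, zero_add, Fin.val_last,
    coeff_smul, hT, smul_eq_mul]
  intro n _
  rw [coeff_smul, coeff_eq_zero_of_natDegree_lt, smul_zero]
  rw [Chebyshev.natDegree_T, Int.natAbs_natCast]
  exact n.2

/-- `T N` has leading coefficient `2 ^ (N - 1)`; for `N ≥ 1` the natural and the integer exponents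
agree. -/
theorem leading_iff (hN : 1 ≤ N) (p : Fin (N + 1) → ℝ) :
    p (Fin.last N) = 1 / (2 : ℝ) ^ ((N : ℤ) - 1) ↔ (chebSum p).coeff N = 1 := by
  have : (N : ℤ) - 1 = ((N - 1 : ℕ) : ℤ) := by omega
  rw [coeff_chebSum, this, zpow_natCast, eq_div_iff (by positivity)]

theorem chebSum_chebCoeff {P : ℝ[X]} (hP : P.natDegree ≤ N) :
    chebSum (fun n : Fin (N + 1) => chebCoeff P n) = P := by
  conv_rhs => rw [eq_sum_chebCoeff hP]
  rw [chebSum, Finset.sum_range]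

theorem mulMatrix_mulVec (Om : ℝ[X]) (M : ℕ) (p : Fin (N + 1) → ℝ) (m : Fin (M + 1)) :
    (mulMatrix Om M N).mulVec p m = chebCoeff (Om * chebSum p) m := by
  simp only [mulMatrix, Matrix.mulVec, dotProduct, Matrix.of_apply, chebSum, Finset.mul_sum,
    chebCoeff, map_sum, Finsupp.coe_finsetSum, Finset.sum_apply, mul_smul_comm, map_smul,
    Finsupp.smul_apply, smul_eq_mul]
  exact Finset.sum_congr rfl fun n _ => mul_comm _ _

/-- The polynomial `c * S ± Om * ∑ p n • T n` whose nonnegativity the program certifies. -/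
noncomputable def constraintPoly (S Om : ℝ[X]) (c : ℝ) (p : Fin (N + 1) → ℝ) (s : ℤˣ) : ℝ[X] :=
  C c * S + C ((s : ℤ) : ℝ) * (Om * chebSum p)

theorem natDegree_constraintPoly_le (S Om : ℝ[X]) (c : ℝ) (p : Fin (N + 1) → ℝ) (s : ℤˣ) :
    (constraintPoly S Om c p s).natDegree ≤ sdpDegree S Om N := by
  refine natDegree_add_le_of_degree_le ?_ ?_
  · exact (natDegree_C_mul_le _ _).trans (le_max_left _ _)
  · exact (natDegree_C_mul_le _ _).trans ((natDegree_mul_le.trans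
      (Nat.add_le_add_left (natDegree_chebSum_le p) _)).trans (le_max_right _ _))

theorem cosCoeff_constraintPoly (S Om : ℝ[X]) (c : ℝ) (p : Fin (N + 1) → ℝ) (s : ℤˣ) {M : ℕ}
    (m : Fin (M + 1)) : cosCoeff (constraintPoly S Om c p s) m = (if m = 0 then 1 else 1 / 2) *
        (chebCoeff S m * c + ((s : ℤ) : ℝ) * (mulMatrix Om M N).mulVec p m) := by
  rw [cosCoeff, constraintPoly, mulMatrix_mulVec, chebCoeff_add, chebCoeff_C_mul, chebCoeff_C_mul,
    Int.natAbs_natCast, mul_comm c]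
  congr 1
  exact if_congr (by rw [Fin.ext_iff, Fin.val_zero, Nat.cast_eq_zero]) rfl rfl

theorem eval_constraintPoly_nonneg_iff {S Om : ℝ[X]} {c x : ℝ} {p : Fin (N + 1) → ℝ}
    (hS : 0 < S.eval x) :
    (∀ s : ℤˣ, 0 ≤ (constraintPoly S Om c p s).eval x) ↔
      |(chebSum p).eval x / ratWeight S Om x| ≤ c := by
  rw [ratWeight, div_div_eq_mul_div, abs_div, abs_of_pos hS, div_le_iff₀ hS, abs_le]
  simp only [constraintPoly, eval_add, eval_mul, eval_C]
  constructor
  · intro h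
    have h1 := h 1
    have h2 := h (-1)
    simp only [Units.val_one, Units.val_neg, Int.cast_neg, Int.cast_one] at h1 h2
    constructor <;> linarith
  · rintro ⟨h1, h2⟩ s
    rcases Int.units_eq_one_or s with rfl | rfl <;>
      simp only [Units.val_one, Units.val_neg, Int.cast_neg, Int.cast_one] <;> linarith

variable {L : ℕ} {a b : Fin L → ℝ} {S Om : ℝ[X]}

theorem exists_sdpFeasible_iff (hab : IsIntervalSystem a b)
    (hS : ∀ x ∈ intervalUnion a b, 0 < S.eval x)
    (c : ℝ) (p : Fin (N + 1) → ℝ) :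
    (∃ v : SDPVar L (sdpDegree S Om N) N,
      v.c = c ∧ v.p = p ∧ SDPFeasible a b S Om (sdpDegree S Om N) N v) ↔
      p (Fin.last N) = 1 / (2 : ℝ) ^ ((N : ℤ) - 1) ∧
        ∀ x ∈ intervalUnion a b, |(chebSum p).eval x / ratWeight S Om x| ≤ c := by
  have hcert := fun (s : ℤˣ) (l : Fin L) => exists_linear_constraint_iff
    (natDegree_constraintPoly_le S Om c p s) (hab.neg_one_le l) (hab.lt l) (hab.le_one l)
  simp only [cosCoeff_constraintPoly] at hcert
  constructor
  · rintro ⟨v, rfl, rfl, hv⟩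
    refine ⟨hv.leading, fun x hx => (eval_constraintPoly_nonneg_iff (hS x hx)).mp ?_⟩
    intro s
    obtain ⟨l, hl⟩ := Set.mem_iUnion.mp hx
    exact (hcert s l).mp ⟨v.Q s l, v.R s l, hv.Q_psd s l, hv.R_psd s l, hv.linear s l⟩ x hl
  · rintro ⟨hlead, h⟩
    have hex := fun s l => (hcert s l).mpr fun x hx => by
      have hx' : x ∈ intervalUnion a b := Set.mem_iUnion.mpr ⟨l, hx⟩
      exact (eval_constraintPoly_nonneg_iff (hS x hx')).mpr (h x hx') s
    choose Q R hQ hR hlin using hex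
    exact ⟨⟨c, p, Q, R⟩, rfl, rfl, hlead, hQ, hR, hlin⟩

end Program

end ChebSDP

theorem mainTheorem3 (L N : ℕ) (hL : 1 ≤ L) (hN : 1 ≤ N) (a b : Fin L → ℝ)
    (hab : ChebSDP.IsIntervalSystem a b) (S Om : Polynomial ℝ)
    (hS : ∀ x ∈ ChebSDP.intervalUnion a b, 0 < S.eval x)
    (hOm : ∀ x ∈ ChebSDP.intervalUnion a b, 0 < Om.eval x) :
    ∃ P : Polynomial ℝ,
      (∀ P' : Polynomial ℝ,
        ChebSDP.IsChebyshevPoly (ChebSDP.intervalUnion a b) (ChebSDP.ratWeight S Om) N P' ↔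
          P' = P) ∧
      (∃ v : ChebSDP.SDPVar L (ChebSDP.sdpDegree S Om N) N,
        ChebSDP.SDPSolves a b S Om (ChebSDP.sdpDegree S Om N) N v) ∧
      ∀ v : ChebSDP.SDPVar L (ChebSDP.sdpDegree S Om N) N,
        ChebSDP.SDPSolves a b S Om (ChebSDP.sdpDegree S Om N) N v →
          ChebSDP.chebSum v.p = P ∧
          v.c = ChebSDP.weightedNorm (ChebSDP.intervalUnion a b) (ChebSDP.ratWeight S Om) P := by
  open ChebSDP in
  set K := intervalUnion a b
  set w := ratWeight S Om
  have hK : IsCompact K := isCompact_iUnion fun l => isCompact_Icc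
  have hinf : K.Infinite := (Set.Icc_infinite (hab.lt ⟨0, hL⟩)).mono
    (Set.subset_iUnion (fun l => Set.Icc (a l) (b l)) ⟨0, hL⟩)
  have hw : ContinuousOn w K := S.continuous.continuousOn.div Om.continuous.continuousOn
    fun x hx => (hOm x hx).ne'
  have hpos : ∀ x ∈ K, 0 < w x := fun x hx => div_pos (hS x hx) (hOm x hx)
  obtain ⟨P, hP⟩ := exists_isChebyshevPoly hK hinf.nonempty hw hpos N
  have hfeas : ∀ v : SDPVar L (sdpDegree S Om N) N, SDPFeasible a b S Om (sdpDegree S Om N) N v →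
      (chebSum v.p).Monic ∧ (chebSum v.p).natDegree = N ∧ weightedNorm K w (chebSum v.p) ≤ v.c := by
    intro v hv
    obtain ⟨hlead, hle⟩ := (exists_sdpFeasible_iff hab hS v.c v.p).mp ⟨v, rfl, rfl, hv⟩
    rw [leading_iff hN] at hlead
    have hd := natDegree_chebSum_le v.p
    exact ⟨monic_of_natDegree_le_of_coeff_eq_one N hd hlead,
      natDegree_eq_of_le_of_coeff_ne_zero hd (by rw [hlead]; exact one_ne_zero),
      weightedNorm_le hinf.nonempty hle⟩
  have hPsum := chebSum_chebCoeff hP.natDegree_eq.le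
  obtain ⟨v₀, hc₀, hp₀, hv₀⟩ := (exists_sdpFeasible_iff hab hS (weightedNorm K w P)
    (fun n : Fin (N + 1) => chebCoeff P n)).mpr
    ⟨(leading_iff hN _).mpr (by
        have := hP.monic.coeff_natDegree
        rwa [hP.natDegree_eq, ← hPsum] at this),
      fun x hx => by
        rw [hPsum]
        exact le_weightedNorm hK hw hpos P hx⟩
  refine ⟨P, fun P' => ⟨fun h => h.eq hK hinf hw hpos hP, fun h => h ▸ hP⟩,
    ⟨v₀, hv₀, fun v hv => ?_⟩, fun v hv => ?_⟩
  · obtain ⟨hm, hd, hle⟩ := hfeas v hv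
    rw [hc₀]
    exact (hP.norm_le _ hm hd).trans hle
  · obtain ⟨hm, hd, hle⟩ := hfeas v hv.feasible
    have hcle : v.c ≤ weightedNorm K w P := hc₀ ▸ hv.minimal v₀ hv₀
    -- The optimal `c` is at most the minimal norm, so the polynomial of any solution is itself a
    -- minimizer and uniqueness applies.
    have hch : IsChebyshevPoly K w N (chebSum v.p) :=
      ⟨hm, hd, fun P' hm' hd' => (hle.trans hcle).trans (hP.norm_le P' hm' hd')⟩
    have heq := hch.eq hK hinf hw hpos hP
    exact ⟨heq, hcle.antisymm (heq ▸ hle)⟩
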